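/- For $n\ge 0$ let $[n]_{p,q}=\sum_{i=0}^{n-1}p^{\,n-1-i}q^{i}$ (so $[0]_{p,q}=0$), and let $$A(q,p,x,y)=\cfrac{1}{1-b_0x-\cfrac{\lambda_1x^2}{1-b_1x-\cfrac{\lambda_2x^2}{1-b_2x-\cfrac{\lambda_3x^2}{\ddots}}}},\qquad b_n=(1+y)[n+1]_{p,q},\quad \lambda_n=y\,q\,[n]_{p,q}^2,$$ regarded as a formal power series in $x$ with coefficients in $\mathbb Z[y,q,p]$ (the coefficientwise limit of the finite truncations of the continued fraction). A decorated permutation of $[n]=\{1,\dots,n\}$ is a permutation $\sigma$ of $[n]$ together with a colouring of its fixed points by $\{+,-\}$. Write $i\le_+\sigma(i)$ if $i<\sigma(i)$, or $i=\sigma(i)$ is coloured $+$; write $i\ge_-\sigma(i)$ if $i>\sigma(i)$, or $i=\sigma(i)$ is coloured $-$. For a decorated permutation $\sigma$: - the number of weak exceedances is $|\{i : i\le_+\sigma(i)\}|$, and the number of non-exceedances is $|\{i : i>\sigma(i)\}|$; - the number of crossings is $\sum_{i=1}^n\big(|\{j : i<j\le\sigma(i)<\sigma(j)\}|+|\{j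 : j>i>\sigma(j)>\sigma(i)\}|\big)$; - the number of nestings is $\sum_{i=1}^n\big(|\{j : j<i\le_+\sigma(i)<\sigma(j)\}|+|\{j : j>i\ge_-\sigma(i)>\sigma(j)\}|\big)$. **Proposition.** For all integers $n,k,\ell,m\ge 0$, the coefficient of $x^n y^k q^\ell p^m$ in $A(q,p,x,y)$ is the number of decorated permutations of $[n]$ with $k$ weak exceedances, with number of crossings plus number of non-exceedances equal to $\ell$, and with $m$ nestings. -/

import Mathlib

open Finset

/-- The two-variable integer
`[n]_{p,q} = p^(n-1) + p^(n-2) q + ⋯ + p q^(n-2) + q^(n-1)`, with `[0]_{p,q} = 0`. -/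
def pqNumber {R : Type*} [CommSemiring R] (p q : R) (n : ℕ) : R :=
  ∑ i ∈ range n, p ^ (n - 1 - i) * q ^ i

section JFraction

variable {R : Type*} [CommRing R]

/-- `jConvergent b lam N j` is the finite continued fraction with `N` levels which starts at
level `j`,
`1 / (1 - b_j x - lam_{j+1} x² / (1 - b_{j+1} x - ⋯ / (1 - b_{j+N-1} x)))`,
as a formal power series in `x`; the empty fraction (`N = 0`) is `0`. Every denominator has
constant coefficient `1`, so `PowerSeries.invOfUnit _ 1` is its inverse. -/
noncomputable def jConvergent (b lam : ℕ → R) : ℕ → ℕ → PowerSeries R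
  | 0, _ => 0
  | N + 1, j =>
      PowerSeries.invOfUnit
        (1 - PowerSeries.C (b j) * PowerSeries.X
          - PowerSeries.C (lam (j + 1)) * PowerSeries.X ^ 2 * jConvergent b lam N (j + 1)) 1

/-- The denominators occurring in `jConvergent` are really inverted. -/
theorem jConvergent_mul_denominator (b lam : ℕ → R) (N j : ℕ) :
    jConvergent b lam (N + 1) j *
      (1 - PowerSeries.C (b j) * PowerSeries.X
        - PowerSeries.C (lam (j + 1)) * PowerSeries.X ^ 2 * jConvergent b lam N (j + 1)) = 1 := by
  rw [jConvergent, mul_comm]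
  apply PowerSeries.mul_invOfUnit
  simp

/-- Consecutive convergents agree up to order `x^(2N)`. -/
theorem X_pow_dvd_jConvergent_sub (b lam : ℕ → R) (N K j : ℕ) :
    (PowerSeries.X : PowerSeries R) ^ (2 * N) ∣
      jConvergent b lam (N + K) j - jConvergent b lam N j := by
  induction N generalizing j with
  | zero => simp
  | succ N ih =>
    obtain ⟨D, hD⟩ := ih (j + 1)
    have h1 := jConvergent_mul_denominator b lam (N + K) j
    have h2 := jConvergent_mul_denominator b lam N j
    have e : N + 1 + K = N + K + 1 := by omega
    rw [e]
    refine ⟨jConvergent b lam (N + K + 1) j * jConvergent b lam (N + 1) j *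
      PowerSeries.C (lam (j + 1)) * D, ?_⟩
    have hx : (PowerSeries.X : PowerSeries R) ^ (2 * (N + 1)) =
        PowerSeries.X ^ 2 * PowerSeries.X ^ (2 * N) := by ring
    rw [hx]
    linear_combination (jConvergent b lam (N + 1) j) * h1 - (jConvergent b lam (N + K + 1) j) * h2 +
      (jConvergent b lam (N + K + 1) j) * (jConvergent b lam (N + 1) j) *
        PowerSeries.C (lam (j + 1)) * PowerSeries.X ^ 2 * hD

/-- The infinite Jacobi continued fraction
`1 / (1 - b_0 x - lam_1 x² / (1 - b_1 x - lam_2 x² / (1 - b_2 x - ⋯)))`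
as a formal power series in `x`: the coefficientwise limit of its convergents, whose `n`-th
coefficients are constant from the convergent with `n + 1` levels on
(see `coeff_jConvergent_eq`). -/
noncomputable def jFraction (b lam : ℕ → R) : PowerSeries R :=
  PowerSeries.mk fun n => PowerSeries.coeff n (jConvergent b lam (n + 1) 0)

/-- The convergents converge to `jFraction`, coefficient by coefficient. -/
theorem coeff_jConvergent_eq (b lam : ℕ → R) {n N : ℕ} (h : n < N) :
    PowerSeries.coeff n (jConvergent b lam N 0) = PowerSeries.coeff n (jFraction b lam) := by
  obtain ⟨K, rfl⟩ := Nat.exists_eq_add_of_le (Nat.succ_le_of_lt h)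
  have := (PowerSeries.X_pow_dvd_iff.mp (X_pow_dvd_jConvergent_sub b lam (n + 1) K 0)) n (by omega)
  rw [map_sub, sub_eq_zero] at this
  simpa [jFraction] using this

end JFraction

/-- The power series `A(q, p, x, y)`: the J-fraction in `x` with `b_n = (1 + y) [n+1]_{p,q}` and
`lam_n = y q [n]_{p,q}²`, over the polynomials in `y = X 0`, `q = X 1`, `p = X 2`. -/
noncomputable def decoratedSeries : PowerSeries (MvPolynomial (Fin 3) ℤ) :=
  let y : MvPolynomial (Fin 3) ℤ := MvPolynomial.X 0
  let q : MvPolynomial (Fin 3) ℤ := MvPolynomial.X 1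
  let p : MvPolynomial (Fin 3) ℤ := MvPolynomial.X 2
  jFraction (fun n => (1 + y) * pqNumber p q (n + 1)) (fun n => y * q * pqNumber p q n ^ 2)

/-- A decorated permutation of `n` linearly ordered letters (here `Fin n`): a permutation
together with a colouring of its fixed points by `+` (`true`) and `-` (`false`). -/
structure DecoratedPerm (n : ℕ) where
  perm : Equiv.Perm (Fin n)
  color : {i : Fin n // perm i = i} → Bool

namespace DecoratedPerm

variable {n : ℕ}

/-- A decorated permutation is a permutation with a two-colouring of its fixed points. -/
def equivSigma (n : ℕ) :
    (Σ s : Equiv.Perm (Fin n), {i : Fin n // s i = i} → Bool) ≃ DecoratedPerm n where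
  toFun s := ⟨s.1, s.2⟩
  invFun s := ⟨s.perm, s.color⟩
  left_inv _ := rfl
  right_inv _ := rfl

instance : Fintype (DecoratedPerm n) := Fintype.ofEquiv _ (equivSigma n)

/-- `i ≤₊ σ(i)`: either `i < σ(i)`, or `i` is a fixed point coloured `+`. -/
def LePlus (s : DecoratedPerm n) (i : Fin n) : Prop :=
  i < s.perm i ∨ ∃ h : s.perm i = i, s.color ⟨i, h⟩ = true

/-- `i ≥₋ σ(i)`: either `i > σ(i)`, or `i` is a fixed point coloured `-`. -/
def GeMinus (s : DecoratedPerm n) (i : Fin n) : Prop :=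
  s.perm i < i ∨ ∃ h : s.perm i = i, s.color ⟨i, h⟩ = false

instance (s : DecoratedPerm n) : DecidablePred s.LePlus := fun i =>
  inferInstanceAs (Decidable (i < s.perm i ∨ ∃ h : s.perm i = i, s.color ⟨i, h⟩ = true))

instance (s : DecoratedPerm n) : DecidablePred s.GeMinus := fun i =>
  inferInstanceAs (Decidable (s.perm i < i ∨ ∃ h : s.perm i = i, s.color ⟨i, h⟩ = false))

/-- The number of weak exceedances: the indices `i` with `i ≤₊ σ(i)`. -/
def weakExceedances (s : DecoratedPerm n) : ℕ := #{i : Fin n | s.LePlus i}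

/-- The number of non-exceedances: the indices `i` with `i > σ(i)`. -/
def nonExceedances (s : DecoratedPerm n) : ℕ := #{i : Fin n | s.perm i < i}

/-- `C₊(i) = {j | i < j ≤ σ(i) < σ(j)}`. -/
def crossPlus (s : DecoratedPerm n) (i : Fin n) : Finset (Fin n) :=
  {j | i < j ∧ j ≤ s.perm i ∧ s.perm i < s.perm j}

/-- `C₋(i) = {j | j > i > σ(j) > σ(i)}`. -/
def crossMinus (s : DecoratedPerm n) (i : Fin n) : Finset (Fin n) :=
  {j | i < j ∧ s.perm j < i ∧ s.perm i < s.perm j}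

/-- `A₊(i) = {j | j < i ≤₊ σ(i) < σ(j)}`. -/
def nestPlus (s : DecoratedPerm n) (i : Fin n) : Finset (Fin n) :=
  {j | j < i ∧ s.LePlus i ∧ s.perm i < s.perm j}

/-- `A₋(i) = {j | j > i ≥₋ σ(i) > σ(j)}`. -/
def nestMinus (s : DecoratedPerm n) (i : Fin n) : Finset (Fin n) :=
  {j | i < j ∧ s.GeMinus i ∧ s.perm j < s.perm i}

/-- The number of crossings, `C₊(σ) + C₋(σ)`. -/
def crossings (s : DecoratedPerm n) : ℕ :=
  ∑ i, #(s.crossPlus i) + ∑ i, #(s.crossMinus i)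

/-- The number of nestings, `A₊(σ) + A₋(σ)`. -/
def nestings (s : DecoratedPerm n) : ℕ :=
  ∑ i, #(s.nestPlus i) + ∑ i, #(s.nestMinus i)

end DecoratedPerm

/-! ### Continued fractions and weighted Motzkin paths. -/

section MotzkinPaths

variable {R : Type*} [CommRing R]

/-! By Flajolet's theorem (`coeff_jFraction`) both sides become sums to compare: weighted Motzkin
paths and decorated permutations. The colour of a fixed point affects only its own factor, so
summing over colourings leaves a product of arc weights over plain permutations
(`sum_color_weight`).

A permutation is then built by a sweep over `t`: decide whether position `t` takes a value below
`t`, then whether value `t` is taken by a position at most `t`. The letters below `t` left unmatched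
are `h` open positions and `h` open values. When an arc is closed, its crossings and nestings are
the numbers of open letters on either side of the chosen one, so summing over choices gives a
`pqNumber` (`sum_rank_weight`). Hence the total weight of all completions depends only on `h`
(`sum_completions_eq`). One step of the sweep raises `h` with weight `1`, keeps it with weight
`y[h+1] + p^h + q[h] = (1+y)[h+1]`, or lowers it with weight `q[h] * y[h]`, exactly as in the
Motzkin recursion. -/

/-- The weighted number of Motzkin paths with `n` steps from height `h` to height `0`: level steps
at height `h` have weight `b h`, down steps from height `h` have weight `lam h`. -/
def motzkinSum (b lam : ℕ → R) : ℕ → ℕ → R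
  | 0, 0 => 1
  | 0, _ + 1 => 0
  | n + 1, 0 => motzkinSum b lam n 1 + b 0 * motzkinSum b lam n 0
  | n + 1, h + 1 => motzkinSum b lam n (h + 2) + b (h + 1) * motzkinSum b lam n (h + 1)
      + lam (h + 1) * motzkinSum b lam n h

/-- The generating function of Motzkin paths from height `h` to `0`, in terms of convergents. -/
noncomputable def convergentProd (b lam : ℕ → R) (N : ℕ) : ℕ → PowerSeries R
  | 0 => jConvergent b lam N 0
  | h + 1 => convergentProd b lam N h * PowerSeries.X * PowerSeries.C (lam (h + 1)) *
      jConvergent b lam (N - (h + 1)) (h + 1)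

theorem convergentProd_zero_eq (b lam : ℕ → R) {N : ℕ} (hN : 0 < N) :
    convergentProd b lam N 0 = 1 + PowerSeries.X * (convergentProd b lam N 1
      + PowerSeries.C (b 0) * convergentProd b lam N 0) := by
  obtain ⟨K, rfl⟩ := Nat.exists_eq_add_of_lt hN
  have h1 := jConvergent_mul_denominator b lam K 0
  simp only [convergentProd, zero_add, Nat.add_sub_cancel] at h1 ⊢
  linear_combination h1

/-- First-step decomposition of a path: the denominator identity at level `h + 1`, multiplied by the
factors of the lower levels. The bound on `h` makes the convergent at that level nonempty. -/
theorem convergentProd_succ_eq (b lam : ℕ → R) {N h : ℕ} (hN : h + 1 < N) :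
    convergentProd b lam N (h + 1) = PowerSeries.X * (convergentProd b lam N (h + 2)
      + PowerSeries.C (b (h + 1)) * convergentProd b lam N (h + 1)
      + PowerSeries.C (lam (h + 1)) * convergentProd b lam N h) := by
  obtain ⟨K, rfl⟩ := Nat.exists_eq_add_of_lt hN
  have h1 := jConvergent_mul_denominator b lam K (h + 1)
  have e1 : h + 1 + K + 1 - (h + 1) = K + 1 := by omega
  have e2 : h + 1 + K + 1 - (h + 1 + 1) = K := by omega
  simp only [convergentProd, e1, e2] at h1 ⊢
  linear_combination (PowerSeries.X * PowerSeries.C (lam (h + 1)) *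
    convergentProd b lam (h + 1 + K + 1) h) * h1

/-- A step uses up one unit of `n` and raises `h` by at most one, so `n + h` never grows and the
truncation at `N` is never reached. -/
theorem coeff_convergentProd (b lam : ℕ → R) (N n h : ℕ) (hN : n + h < N) :
    PowerSeries.coeff n (convergentProd b lam N h) = motzkinSum b lam n h := by
  induction n generalizing h with
  | zero =>
    cases h with
    | zero => rw [convergentProd_zero_eq b lam (by omega)]; simp [motzkinSum]
    | succ h => rw [convergentProd_succ_eq b lam (by omega)]; simp [motzkinSum]
  | succ n ih =>
    cases h with
    | zero =>
      rw [convergentProd_zero_eq b lam (by omega), map_add, PowerSeries.coeff_succ_X_mul, map_add,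
        PowerSeries.coeff_C_mul, ih 1 (by omega), ih 0 (by omega)]
      simp [motzkinSum, PowerSeries.coeff_one]
    | succ h =>
      rw [convergentProd_succ_eq b lam (by omega), PowerSeries.coeff_succ_X_mul, map_add, map_add,
        PowerSeries.coeff_C_mul, PowerSeries.coeff_C_mul, ih _ (by omega), ih _ (by omega),
        ih _ (by omega), motzkinSum]

/-- Flajolet's theorem: a Jacobi continued fraction counts weighted Motzkin paths. -/
theorem coeff_jFraction (b lam : ℕ → R) (n : ℕ) :
    PowerSeries.coeff n (jFraction b lam) = motzkinSum b lam n 0 := by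
  rw [← coeff_jConvergent_eq b lam (Nat.lt_succ_self n)]
  exact coeff_convergentProd b lam (n + 1) n 0 (by omega)

end MotzkinPaths

/-! ### Rank sums giving `pqNumber`. -/

section RankSums

variable {R : Type*} [CommRing R]

theorem pqNumber_succ (p q : R) (n : ℕ) : pqNumber p q (n + 1) = p ^ n + q * pqNumber p q n := by
  rw [pqNumber, sum_range_succ', pqNumber, mul_sum, add_comm]
  congr 1
  · simp
  · refine sum_congr rfl fun i hi => ?_
    rw [show n + 1 - 1 - (i + 1) = n - 1 - i by omega]
    ring

/-- A new maximum contributes `p ^ #S` and gives every earlier term one more factor `q`, which is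
the recursion `pqNumber_succ`. -/
theorem sum_rank_weight {α : Type*} [LinearOrder α] (p q : R) (S : Finset α) :
    ∑ i ∈ S, p ^ #{j ∈ S | j < i} * q ^ #{j ∈ S | i < j} = pqNumber p q #S := by
  induction S using Finset.induction_on_max with
  | empty => simp [pqNumber]
  | insert a S ha ih =>
    have hn : a ∉ S := fun h => lt_irrefl _ (ha a h)
    rw [sum_insert hn, card_insert_of_notMem hn, pqNumber_succ, ← ih, mul_sum]
    congr 1
    · have h1 : #{j ∈ insert a S | j < a} = #S := by
        congr 1; ext j; simp only [mem_filter, mem_insert]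
        exact ⟨fun h => h.1.resolve_left h.2.ne, fun h => ⟨Or.inr h, ha j h⟩⟩
      have h2 : #{j ∈ insert a S | a < j} = 0 := by
        rw [card_eq_zero, filter_eq_empty_iff]
        intro j hj
        rcases mem_insert.1 hj with rfl | hj
        · exact lt_irrefl _
        · exact (ha j hj).asymm
      rw [h1, h2]; simp
    · refine sum_congr rfl fun i hi => ?_
      rw [filter_insert, filter_insert, if_neg (ha i hi).asymm, if_pos (ha i hi),
        card_insert_of_notMem (by simp [hn])]
      ring

end RankSums

/-! ### Partial permutations: one step of the sweep. -/

section Completions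

variable {R : Type*} [CommRing R] {n : ℕ}

/-- The weight of the arc `i → σ i` if it goes down, and `1` otherwise. -/
def downWeight (p q : R) (σ : Equiv.Perm (Fin n)) (i : Fin n) : R :=
  if σ i < i then
    q * (p ^ #{j | i < j ∧ σ j < σ i} * q ^ #{j | i < j ∧ σ j < i ∧ σ i < σ j})
  else 1

/-- The weight of the arc `i → σ i` if it goes up, the total weight of the two colours of a fixed
point `i`, and `1` otherwise. -/
def upWeight (p q y : R) (σ : Equiv.Perm (Fin n)) (i : Fin n) : R :=
  if i ≤ σ i then
    y * (p ^ #{j | j < i ∧ σ i < σ j} * q ^ #{j | i < j ∧ j ≤ σ i ∧ σ i < σ j})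
      + (if σ i = i then p ^ #{j | i < j ∧ σ j < σ i} else 0)
  else 1

/-- The contribution of the down arcs from positions `≥ a` and the other arcs to values `≥ b`. -/
def suffixWeight (p q y : R) (a b : ℕ) (σ : Equiv.Perm (Fin n)) : R :=
  (∏ i with a ≤ i.val, downWeight p q σ i) * ∏ i with b ≤ (σ i).val, upWeight p q y σ i

/-- The permutations which agree with `f` on `D` and send all positions below `a` outside `D` to
values which are at least `b`. -/
def completions (a b : ℕ) (D : Finset (Fin n)) (f : Fin n → Fin n) :
    Finset (Equiv.Perm (Fin n)) :=
  {σ | (∀ i ∈ D, σ i = f i) ∧ ∀ i ∉ D, i.val < a → b ≤ (σ i).val}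

theorem suffixWeight_position (p q y : R) (t : Fin n) (b : ℕ) (σ : Equiv.Perm (Fin n)) :
    suffixWeight p q y t b σ = downWeight p q σ t * suffixWeight p q y (t + 1) b σ := by
  have h : ({i : Fin n | t.val ≤ i.val} : Finset (Fin n)) =
      insert t ({i : Fin n | t.val + 1 ≤ i.val} : Finset (Fin n)) := by
    ext i; simp only [mem_filter, mem_univ, true_and, mem_insert, Fin.ext_iff]; omega
  rw [suffixWeight, h, prod_insert (by simp), suffixWeight, mul_assoc]

theorem suffixWeight_value (p q y : R) (i : Fin n) (a : ℕ) (σ : Equiv.Perm (Fin n)) :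
    suffixWeight p q y a (σ i) σ = upWeight p q y σ i * suffixWeight p q y a (σ i + 1) σ := by
  have h : ({j : Fin n | (σ i).val ≤ (σ j).val} : Finset (Fin n)) =
      insert i ({j : Fin n | (σ i).val + 1 ≤ (σ j).val} : Finset (Fin n)) := by
    ext j
    simp only [mem_filter, mem_univ, true_and, mem_insert]
    rw [← σ.injective.eq_iff, Fin.ext_iff]; omega
  rw [suffixWeight, h, prod_insert (by simp), suffixWeight]
  ring

variable {D : Finset (Fin n)} {f : Fin n → Fin n} {t : Fin n}

theorem mem_completions {a b : ℕ} {σ : Equiv.Perm (Fin n)} : σ ∈ completions a b D f ↔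
    (∀ i ∈ D, σ i = f i) ∧ ∀ i ∉ D, i.val < a → b ≤ (σ i).val := by
  simp [completions]

theorem filter_completions_position_open (hD : ∀ i ∈ D, i < t) :
    {σ ∈ completions t t D f | ¬ σ t < t} = completions (t + 1) t D f := by
  have htD : t ∉ D := fun h => lt_irrefl _ (hD t h)
  ext σ
  simp only [mem_filter, mem_completions, not_lt, Fin.le_def]
  constructor
  · rintro ⟨⟨h1, h2⟩, h3⟩
    refine ⟨h1, fun i hi hit => ?_⟩
    rcases Nat.lt_succ_iff_lt_or_eq.1 hit with h | h
    · exact h2 i hi h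
    · rw [Fin.ext h]; exact h3
  · rintro ⟨h1, h2⟩
    exact ⟨⟨h1, fun i hi hit => h2 i hi (by omega)⟩, h2 t htD (by omega)⟩

theorem filter_completions_position_closed (hD : ∀ i ∈ D, i < t) (v : Fin n) (hv : v < t) :
    {σ ∈ completions t t D f | σ t < t ∧ σ t = v} =
      completions (t + 1) t (insert t D) (Function.update f t v) := by
  have htD : t ∉ D := fun h => lt_irrefl _ (hD t h)
  ext σ
  simp only [mem_filter, mem_completions, mem_insert, forall_eq_or_imp, not_or,
    Function.update_self]
  constructor
  · rintro ⟨⟨h1, h2⟩, -, h3⟩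
    refine ⟨⟨h3, fun i hi => ?_⟩, fun i hi hit => h2 i hi.2 ?_⟩
    · rw [Function.update_of_ne (hD i hi).ne]; exact h1 i hi
    · have := Fin.val_ne_of_ne hi.1; omega
  · rintro ⟨⟨h3, h1⟩, h2⟩
    refine ⟨⟨fun i hi => ?_, fun i hi hit => h2 i ⟨?_, hi⟩ (by omega)⟩, h3 ▸ hv, h3⟩
    · rw [h1 i hi, Function.update_of_ne (hD i hi).ne]
    · rintro rfl; exact lt_irrefl _ hit

/-- Open positions below `t` only receive values at least `t`, so the open values other than `v` are
taken exactly by positions after `t`: the smaller ones nest with the arc `t → v`, the larger ones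
cross it. -/
theorem downWeight_of_mem (p q : R) (hD : ∀ i ∈ D, i < t) (v : Fin n) (hv : v < t)
    {σ : Equiv.Perm (Fin n)} (hσ : σ ∈ completions t t D f) (hσt : σ t = v) :
    downWeight p q σ t = q * (p ^ #{u ∈ Iio t \ D.image f | u < v} *
      q ^ #{u ∈ Iio t \ D.image f | v < u}) := by
  rw [mem_completions] at hσ
  obtain ⟨h1, h2⟩ := hσ
  have key : ∀ j, (t < j ∧ σ j < t) ↔ (σ j ∈ Iio t \ D.image f ∧ σ j ≠ v) := by
    intro j
    simp only [mem_sdiff, mem_Iio, mem_image, not_exists, not_and]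
    constructor
    · rintro ⟨hj, hj'⟩
      refine ⟨⟨hj', fun i hi hij => ?_⟩, fun h => ?_⟩
      · rw [← h1 i hi, σ.injective.eq_iff] at hij
        exact lt_asymm (hij ▸ hD i hi) hj
      · rw [← hσt, σ.injective.eq_iff] at h; exact hj.ne' h
    · rintro ⟨⟨hj, hj'⟩, hne⟩
      refine ⟨?_, hj⟩
      have hjD : j ∉ D := fun h => hj' j h (h1 j h).symm
      have h3 := h2 j hjD
      have h4 : j ≠ t := by rintro rfl; exact hne hσt
      have := Fin.val_ne_of_ne h4
      rw [Fin.lt_def] at hj ⊢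
      omega
  have e1 : #{j | t < j ∧ σ j < σ t} = #{u ∈ Iio t \ D.image f | u < v} := by
    refine card_bij (fun j _ => σ j) ?_ (fun _ _ _ _ h => σ.injective h) ?_
    · intro j hj
      simp only [mem_filter, mem_univ, true_and, hσt] at hj
      exact mem_filter.2 ⟨((key j).1 ⟨hj.1, hj.2.trans hv⟩).1, hj.2⟩
    · intro u hu
      obtain ⟨hu, huv⟩ := mem_filter.1 hu
      refine ⟨σ.symm u, ?_, by simp⟩
      have := (key (σ.symm u)).2 (by simpa using ⟨by simpa using hu, huv.ne⟩)
      simp [this.1, hσt, huv]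
  have e2 : #{j | t < j ∧ σ j < t ∧ σ t < σ j} = #{u ∈ Iio t \ D.image f | v < u} := by
    refine card_bij (fun j _ => σ j) ?_ (fun _ _ _ _ h => σ.injective h) ?_
    · intro j hj
      simp only [mem_filter, mem_univ, true_and, hσt] at hj
      exact mem_filter.2 ⟨((key j).1 ⟨hj.1, hj.2.1⟩).1, hj.2.2⟩
    · intro u hu
      obtain ⟨hu, huv⟩ := mem_filter.1 hu
      refine ⟨σ.symm u, ?_, by simp⟩
      have := (key (σ.symm u)).2 (by simpa using ⟨by simpa using hu, huv.ne'⟩)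
      rw [Equiv.apply_symm_apply] at this
      simp [this.1, this.2, hσt, huv]
  rw [downWeight, if_pos (hσt ▸ hv), e1, e2]

theorem sum_completions_position (p q y : R) (hD : ∀ i ∈ D, i < t) :
    ∑ σ ∈ completions t t D f, suffixWeight p q y t t σ =
      ∑ σ ∈ completions (t + 1) t D f, suffixWeight p q y (t + 1) t σ +
      ∑ v ∈ Iio t \ D.image f, q * (p ^ #{u ∈ Iio t \ D.image f | u < v} *
        q ^ #{u ∈ Iio t \ D.image f | v < u}) *
        ∑ σ ∈ completions (t + 1) t (insert t D) (Function.update f t v),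
          suffixWeight p q y (t + 1) t σ := by
  rw [← sum_filter_add_sum_filter_not _ (fun σ : Equiv.Perm (Fin n) => σ t < t), add_comm]
  congr 1
  · rw [filter_completions_position_open hD]
    refine sum_congr rfl fun σ hσ => ?_
    rw [suffixWeight_position, downWeight, if_neg, one_mul]
    rw [← filter_completions_position_open hD] at hσ
    exact (mem_filter.1 hσ).2
  · rw [← sum_fiberwise_of_maps_to (t := Iio t \ D.image f) (g := fun σ => σ t)]
    · refine sum_congr rfl fun v hv => ?_
      have hvt : v < t := by simpa using (mem_sdiff.1 hv).1
      rw [filter_filter, ← filter_completions_position_closed hD v hvt, mul_sum]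
      refine sum_congr rfl fun σ hσ => ?_
      obtain ⟨hσ, -, hσt⟩ := mem_filter.1 hσ
      rw [suffixWeight_position, downWeight_of_mem p q hD v hvt hσ hσt]
    · intro σ hσ
      obtain ⟨hσ, hσt⟩ := mem_filter.1 hσ
      simp only [mem_sdiff, mem_Iio, mem_image, not_exists, not_and]
      refine ⟨hσt, fun i hi h => ?_⟩
      rw [← (mem_completions.1 hσ).1 i hi, σ.injective.eq_iff] at h
      exact (hD i hi).ne h

theorem filter_completions_value_open (hf : ∀ i ∈ D, f i < t) :
    {σ ∈ completions (t + 1) t D f | ¬ σ.symm t ≤ t} = completions (t + 1) (t + 1) D f := by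
  ext σ
  simp only [mem_filter, mem_completions, not_le]
  constructor
  · rintro ⟨⟨h1, h2⟩, h3⟩
    refine ⟨h1, fun i hi hit => ?_⟩
    have h4 : σ i ≠ t := by
      intro h
      rw [← h, Equiv.symm_apply_apply] at h3
      rw [h, Fin.lt_def] at h3
      omega
    have := h2 i hi hit
    have := Fin.val_ne_of_ne h4
    omega
  · rintro ⟨h1, h2⟩
    refine ⟨⟨h1, fun i hi hit => (Nat.le_succ _).trans (h2 i hi hit)⟩, ?_⟩
    by_contra hlt
    rw [not_lt, Fin.le_def] at hlt
    by_cases hi : σ.symm t ∈ D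
    · have h3 := h1 _ hi
      have h4 := hf _ hi
      rw [← h3, Equiv.apply_symm_apply] at h4
      exact lt_irrefl _ h4
    · have h3 := h2 _ hi (by omega)
      rw [Equiv.apply_symm_apply] at h3
      omega

theorem filter_completions_value_closed (i : Fin n) (hiD : i ∉ D) (hit : i ≤ t) :
    {σ ∈ completions (t + 1) t D f | σ.symm t ≤ t ∧ σ.symm t = i} =
      completions (t + 1) (t + 1) (insert i D) (Function.update f i t) := by
  ext σ
  simp only [mem_filter, mem_completions, mem_insert, forall_eq_or_imp, not_or,
    Function.update_self]
  constructor
  · rintro ⟨⟨h1, h2⟩, -, h3⟩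
    have h4 : σ i = t := by rw [← h3, Equiv.apply_symm_apply]
    refine ⟨⟨h4, fun j hj => ?_⟩, fun j hj hjt => ?_⟩
    · rw [Function.update_of_ne (by rintro rfl; exact hiD hj)]; exact h1 j hj
    · have h5 := h2 j hj.2 hjt
      have h6 : σ j ≠ t := by rw [← h4, Ne, σ.injective.eq_iff]; exact hj.1
      have := Fin.val_ne_of_ne h6
      omega
  · rintro ⟨⟨h3, h1⟩, h2⟩
    have h4 : σ.symm t = i := by rw [← h3, Equiv.symm_apply_apply]
    refine ⟨⟨fun j hj => ?_, fun j hj hjt => ?_⟩, h4 ▸ hit, h4⟩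
    · rw [h1 j hj, Function.update_of_ne (by rintro rfl; exact hiD hj)]
    · by_cases h : j = i
      · rw [h, h3]
      · exact (Nat.le_succ _).trans (h2 j ⟨h, hj⟩ hjt)

/-- The open positions other than `i` all go above `t`: those before `i` nest with the arc `i → t`,
those after `i` cross it. The extra term is a fixed point coloured `-`, which nests with the arcs
into the `t - #D` open values below it. -/
theorem upWeight_of_mem (p q y : R) (hD : ∀ i ∈ D, i ≤ t) (hf : ∀ i ∈ D, f i < t)
    (hinj : Set.InjOn f D) (i : Fin n) (hiD : i ∉ D) (hit : i ≤ t)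
    {σ : Equiv.Perm (Fin n)} (hσ : σ ∈ completions (t + 1) t D f) (hσi : σ i = t) :
    upWeight p q y σ i = y * (p ^ #{j ∈ Iic t \ D | j < i} * q ^ #{j ∈ Iic t \ D | i < j}) +
      (if i = t then p ^ (t.val - #D) else 0) := by
  rw [mem_completions] at hσ
  obtain ⟨h1, h2⟩ := hσ
  have key : ∀ j, (j ≤ t ∧ t < σ j) ↔ (j ∈ Iic t \ D ∧ j ≠ i) := by
    intro j
    simp only [mem_sdiff, mem_Iic]
    constructor
    · rintro ⟨hj, hj'⟩
      refine ⟨⟨hj, fun h => ?_⟩, ?_⟩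
      · exact lt_asymm hj' (h1 j h ▸ hf j h)
      · rintro rfl; exact hj'.ne' hσi
    · rintro ⟨⟨hj, hj'⟩, hne⟩
      refine ⟨hj, lt_of_le_of_ne (h2 j hj' (Nat.lt_succ_of_le hj)) ?_⟩
      rw [← hσi, Ne, σ.injective.eq_iff]; exact hne.symm
  have e1 : #{j | j < i ∧ σ i < σ j} = #{j ∈ Iic t \ D | j < i} := by
    congr 1; ext j
    simp only [mem_filter, mem_univ, true_and, hσi]
    exact ⟨fun h => ⟨((key j).1 ⟨h.1.le.trans hit, h.2⟩).1, h.1⟩,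
      fun h => ⟨h.2, ((key j).2 ⟨h.1, h.2.ne⟩).2⟩⟩
  have e2 : #{j | i < j ∧ j ≤ σ i ∧ σ i < σ j} = #{j ∈ Iic t \ D | i < j} := by
    congr 1; ext j
    simp only [mem_filter, mem_univ, true_and, hσi]
    exact ⟨fun h => ⟨((key j).1 h.2).1, h.1⟩, fun h => ⟨h.2, (key j).2 ⟨h.1, h.2.ne'⟩⟩⟩
  rw [upWeight, if_pos (hσi ▸ hit), e1, e2, hσi]
  congr 1
  by_cases h : i = t
  · subst h
    rw [if_pos rfl, if_pos rfl]
    have e3 : #{j | i < j ∧ σ j < i} = #(Iio i \ D.image f) := by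
      refine card_bij (fun j _ => σ j) ?_ (fun _ _ _ _ h => σ.injective h) ?_
      · intro j hj
        simp only [mem_filter, mem_univ, true_and] at hj
        simp only [mem_sdiff, mem_Iio, mem_image, not_exists, not_and]
        refine ⟨hj.2, fun k hk hkj => ?_⟩
        rw [← h1 k hk, σ.injective.eq_iff] at hkj
        exact absurd (hD k hk) (by rw [hkj]; exact not_le.2 hj.1)
      · intro u hu
        simp only [mem_sdiff, mem_Iio, mem_image, not_exists, not_and] at hu
        refine ⟨σ.symm u, ?_, by simp⟩
        simp only [mem_filter, mem_univ, true_and, Equiv.apply_symm_apply]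
        refine ⟨?_, hu.1⟩
        have hD' : σ.symm u ∉ D := fun h => hu.2 _ h (by rw [← h1 _ h, Equiv.apply_symm_apply])
        have h3 := h2 _ hD'
        rw [Equiv.apply_symm_apply] at h3
        have := hu.1
        rw [Fin.lt_def] at this ⊢
        omega
    rw [e3, card_sdiff_of_subset, Fin.card_Iio, card_image_of_injOn hinj]
    intro v hv
    obtain ⟨k, hk, rfl⟩ := mem_image.1 hv
    exact mem_Iio.2 (hf k hk)
  · rw [if_neg h, if_neg (fun h' => h h'.symm)]

theorem sum_completions_value (p q y : R) (hD : ∀ i ∈ D, i ≤ t) (hf : ∀ i ∈ D, f i < t)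
    (hinj : Set.InjOn f D) :
    ∑ σ ∈ completions (t + 1) t D f, suffixWeight p q y (t + 1) t σ =
      ∑ σ ∈ completions (t + 1) (t + 1) D f, suffixWeight p q y (t + 1) (t + 1) σ +
      ∑ i ∈ Iic t \ D, (y * (p ^ #{j ∈ Iic t \ D | j < i} * q ^ #{j ∈ Iic t \ D | i < j}) +
        (if i = t then p ^ (t.val - #D) else 0)) *
        ∑ σ ∈ completions (t + 1) (t + 1) (insert i D) (Function.update f i t),
          suffixWeight p q y (t + 1) (t + 1) σ := by
  have step : ∀ σ : Equiv.Perm (Fin n), suffixWeight p q y (t + 1) t σ =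
      upWeight p q y σ (σ.symm t) * suffixWeight p q y (t + 1) (t + 1) σ := by
    intro σ
    have := suffixWeight_value p q y (σ.symm t) (t + 1) σ
    rwa [Equiv.apply_symm_apply] at this
  rw [← sum_filter_add_sum_filter_not _ (fun σ : Equiv.Perm (Fin n) => σ.symm t ≤ t), add_comm]
  congr 1
  · rw [filter_completions_value_open hf]
    refine sum_congr rfl fun σ hσ => ?_
    rw [step, upWeight, if_neg, one_mul]
    rw [← filter_completions_value_open hf] at hσ
    rw [Equiv.apply_symm_apply]
    exact (mem_filter.1 hσ).2
  · rw [← sum_fiberwise_of_maps_to (t := Iic t \ D) (g := fun σ => σ.symm t)]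
    · refine sum_congr rfl fun i hi => ?_
      have hi' := mem_sdiff.1 hi
      have hit : i ≤ t := by simpa using hi'.1
      rw [filter_filter, ← filter_completions_value_closed i hi'.2 hit, mul_sum]
      refine sum_congr rfl fun σ hσ => ?_
      obtain ⟨hσ, -, hσt⟩ := mem_filter.1 hσ
      rw [step, hσt, upWeight_of_mem p q y hD hf hinj i hi'.2 hit hσ
        (by rw [← hσt, Equiv.apply_symm_apply])]
    · intro σ hσ
      obtain ⟨hσ, hσt⟩ := mem_filter.1 hσ
      refine mem_sdiff.2 ⟨mem_Iic.2 hσt, fun h => ?_⟩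
      have h3 := hf _ h
      rw [← (mem_completions.1 hσ).1 _ h, Equiv.apply_symm_apply] at h3
      exact lt_irrefl _ h3

/-- End of the sweep: an open position would need a value at least `n`, so only a total `f` can be
completed, and uniquely. -/
theorem sum_completions_full (p q y : R) (hinj : Set.InjOn f D) :
    ∑ σ ∈ completions n n D f, suffixWeight p q y n n σ = if n = #D then 1 else 0 := by
  have hw : ∀ σ : Equiv.Perm (Fin n), suffixWeight p q y n n σ = 1 := by
    intro σ
    simp [suffixWeight, filter_false_of_mem, not_le.2 (Fin.is_lt _)]
  simp only [hw, sum_const, nsmul_one]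
  split_ifs with h
  · have hD : D = univ := by
      rw [← card_eq_iff_eq_univ, Fintype.card_fin]; exact h.symm
    subst hD
    have hb : Function.Bijective f :=
      Finite.injective_iff_bijective.1 (by simpa [Set.injOn_univ] using hinj)
    have : completions n n univ f = {Equiv.ofBijective f hb} := by
      ext σ
      simp [mem_completions, Equiv.ext_iff]
    simp [this]
  · have : completions n n D f = ∅ := by
      refine eq_empty_of_forall_notMem fun σ hσ => h ?_
      have hD : D = univ := by
        refine eq_univ_of_forall fun i => ?_
        by_contra hi
        exact absurd ((mem_completions.1 hσ).2 i hi i.2) (not_le.2 (σ i).2)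
      simp [hD]
    simp [this]

end Completions

/-! ### The sweep as a Motzkin recursion. -/

section GeneratingFunction

variable {R : Type*} [CommRing R] {n : ℕ}

/-- The weighted Motzkin paths for the continued fraction of decorated permutations. -/
def decoratedMotzkin (p q y : R) : ℕ → ℕ → R :=
  motzkinSum (fun n => (1 + y) * pqNumber p q (n + 1)) (fun n => y * q * pqNumber p q n ^ 2)

/-- At `h = 0` the truncated `h - 1` is harmless, since `pqNumber p q 0 = 0`. -/
theorem decoratedMotzkin_succ (p q y : R) (m h : ℕ) :
    decoratedMotzkin p q y (m + 1) h = decoratedMotzkin p q y m (h + 1)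
      + (1 + y) * pqNumber p q (h + 1) * decoratedMotzkin p q y m h
      + y * q * pqNumber p q h ^ 2 * decoratedMotzkin p q y m (h - 1) := by
  cases h with
  | zero => simp [decoratedMotzkin, motzkinSum, pqNumber]
  | succ h => simp [decoratedMotzkin, motzkinSum]

theorem decoratedMotzkin_zero (p q y : R) (h : ℕ) :
    decoratedMotzkin p q y 0 h = if h = 0 then 1 else 0 := by
  cases h <;> simp [decoratedMotzkin, motzkinSum]

theorem injOn_update {α β : Type*} [DecidableEq α] {f : α → β} {D : Finset α} {i : α} {v : β}
    (hf : Set.InjOn f D) (hi : i ∉ D) (hv : ∀ j ∈ D, f j ≠ v) :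
    Set.InjOn (Function.update f i v) (insert i D : Finset α) := by
  have h : ∀ j ∈ D, Function.update f i v j = f j := fun j hj =>
    Function.update_of_ne (by rintro rfl; exact hi hj) _ _
  intro a ha b hb hab
  rcases mem_insert.1 ha with rfl | ha' <;> rcases mem_insert.1 hb with rfl | hb'
  · rfl
  · rw [Function.update_self, h b hb'] at hab; exact absurd hab.symm (hv b hb')
  · rw [Function.update_self, h a ha'] at hab; exact absurd hab (hv a ha')
  · rw [h a ha', h b hb'] at hab; exact hf ha' hb' hab

/-- The half-step for value `t`, needed both when position `t` was left open and when it was just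
closed; only in the first case can `t` become a fixed point. The induction hypothesis of
`sum_completions_eq` is passed in as `ih`. -/
theorem sum_completions_value_eq (p q y : R) (m : ℕ) {t : Fin n}
    (ih : ∀ (D : Finset (Fin n)) (f : Fin n → Fin n), (∀ i ∈ D, i ≤ t) → (∀ i ∈ D, f i ≤ t) →
      Set.InjOn f D → ∑ σ ∈ completions (t + 1) (t + 1) D f, suffixWeight p q y (t + 1) (t + 1) σ =
        decoratedMotzkin p q y m (t + 1 - #D))
    {D : Finset (Fin n)} {f : Fin n → Fin n} (hD : ∀ i ∈ D, i ≤ t) (hf : ∀ i ∈ D, f i < t)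
    (hinj : Set.InjOn f D) :
    ∑ σ ∈ completions (t + 1) t D f, suffixWeight p q y (t + 1) t σ =
      decoratedMotzkin p q y m (t + 1 - #D) +
      (y * pqNumber p q (t + 1 - #D) + if t ∈ D then 0 else p ^ (t.val - #D)) *
        decoratedMotzkin p q y m (t - #D) := by
  rw [sum_completions_value p q y hD hf hinj, ih D f hD (fun i hi => (hf i hi).le) hinj]
  congr 1
  have hcard : #(Iic t \ D) = t + 1 - #D := by
    rw [card_sdiff_of_subset (fun i hi => mem_Iic.2 (hD i hi)), Fin.card_Iic]
  have hin : ∀ i ∈ Iic t \ D,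
      ∑ σ ∈ completions (t + 1) (t + 1) (insert i D) (Function.update f i t),
        suffixWeight p q y (t + 1) (t + 1) σ = decoratedMotzkin p q y m (t - #D) := by
    intro i hi
    obtain ⟨hit, hiD⟩ := mem_sdiff.1 hi
    rw [ih, card_insert_of_notMem hiD, Nat.add_sub_add_right]
    · simpa using ⟨mem_Iic.1 hit, hD⟩
    · intro j hj
      rcases mem_insert.1 hj with rfl | hj'
      · rw [Function.update_self]
      · rw [Function.update_of_ne (by rintro rfl; exact hiD hj')]; exact (hf j hj').le
    · exact injOn_update hinj hiD fun j hj => (hf j hj).ne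
  rw [sum_congr rfl fun i hi => by rw [hin i hi], ← sum_mul, sum_add_distrib, ← mul_sum,
    sum_rank_weight, hcard, sum_ite_eq']
  simp [ite_not]

theorem sum_completions_eq (p q y : R) (m t : ℕ) (ht : t + m = n) (D : Finset (Fin n))
    (f : Fin n → Fin n) (hD : ∀ i ∈ D, i.val < t) (hf : ∀ i ∈ D, (f i).val < t)
    (hinj : Set.InjOn f D) :
    ∑ σ ∈ completions t t D f, suffixWeight p q y t t σ = decoratedMotzkin p q y m (t - #D) := by
  induction m generalizing t D f with
  | zero =>
    obtain rfl : t = n := by omega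
    rw [sum_completions_full p q y hinj, decoratedMotzkin_zero]
    have : #D ≤ t := by simpa using card_le_univ D
    congr 1
    rw [eq_iff_iff]; omega
  | succ m ih =>
    obtain ⟨s, rfl⟩ : ∃ s : Fin n, s.val = t := ⟨⟨t, by omega⟩, rfl⟩
    have hsD : s ∉ D := fun h => lt_irrefl _ (hD s h)
    have ih' := fun D f (hD : ∀ i ∈ D, i ≤ s) (hf : ∀ i ∈ D, f i ≤ s) =>
      ih (s + 1) (by omega) D f (fun i hi => Nat.lt_succ_of_le (hD i hi))
        (fun i hi => Nat.lt_succ_of_le (hf i hi))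
    have hDcard : #D ≤ s := by
      simpa using card_le_card (fun i hi => mem_Iio.2 (hD i hi) : D ⊆ Iio s)
    have hVcard : #(Iio s \ D.image f) = s - #D := by
      rw [card_sdiff_of_subset, Fin.card_Iio, card_image_of_injOn hinj]
      intro v hv
      obtain ⟨k, hk, rfl⟩ := mem_image.1 hv
      exact mem_Iio.2 (hf k hk)
    rw [sum_completions_position p q y hD,
      sum_completions_value_eq p q y m ih' (fun i hi => (hD i hi).le) hf hinj, if_neg hsD]
    have hin : ∀ v ∈ Iio s \ D.image f,
        ∑ σ ∈ completions (s + 1) s (insert s D) (Function.update f s v),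
          suffixWeight p q y (s + 1) s σ = decoratedMotzkin p q y m (s - #D) +
            y * pqNumber p q (s - #D) * decoratedMotzkin p q y m (s - #D - 1) := by
      intro v hv
      obtain ⟨hvs, hvD⟩ := mem_sdiff.1 hv
      rw [sum_completions_value_eq p q y m ih', card_insert_of_notMem hsD,
        if_pos (mem_insert_self _ _), Nat.add_sub_add_right, add_zero, Nat.sub_sub]
      · simpa using fun i hi => (hD i hi).le
      · intro j hj
        rcases mem_insert.1 hj with rfl | hj'
        · rw [Function.update_self]; exact mem_Iio.1 hvs
        · rw [Function.update_of_ne (by rintro rfl; exact hsD hj')]; exact hf j hj'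
      · exact injOn_update hinj hsD fun j hj h => hvD (mem_image.2 ⟨j, hj, h⟩)
    -- With `h = s - #D`, the level weight is `y[h+1] + p^h` from an open position plus `q[h]` from
    -- a closed one; `pqNumber_succ` merges them.
    rw [sum_congr rfl fun v hv => by rw [hin v hv], ← sum_mul, ← mul_sum, sum_rank_weight, hVcard,
      decoratedMotzkin_succ, Nat.sub_add_comm hDcard, pqNumber_succ]
    ring

theorem sum_perm_weight (p q y : R) :
    ∑ σ : Equiv.Perm (Fin n), (∏ i, downWeight p q σ i) * ∏ i, upWeight p q y σ i =
      decoratedMotzkin p q y n 0 := by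
  -- At `t = 0` nothing is prescribed: all permutations are completions, and `id` is a dummy.
  have h := sum_completions_eq (n := n) p q y n 0 (zero_add n) ∅ id (by simp) (by simp) (by simp)
  simpa [completions, suffixWeight] using h

/-! ### From decorated permutations to arc weights. -/

namespace DecoratedPerm

/-- The contribution of the position `i` to the monomial of a decorated permutation. -/
def posWeight (p q y : R) (s : DecoratedPerm n) (i : Fin n) : R :=
  y ^ (if s.LePlus i then 1 else 0) *
    q ^ (#(s.crossPlus i) + #(s.crossMinus i) + if s.perm i < i then 1 else 0) *
    p ^ (#(s.nestPlus i) + #(s.nestMinus i))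

theorem prod_posWeight (p q y : R) (s : DecoratedPerm n) :
    ∏ i, posWeight p q y s i =
      y ^ s.weakExceedances * q ^ (s.crossings + s.nonExceedances) * p ^ s.nestings := by
  simp only [posWeight, prod_mul_distrib, prod_pow_eq_pow_sum, sum_add_distrib,
    weakExceedances, crossings, nonExceedances, nestings, card_filter]

theorem posWeight_of_ne (p q y : R) (s : DecoratedPerm n) {i : Fin n} (hi : s.perm i ≠ i) :
    posWeight p q y s i = downWeight p q s.perm i * upWeight p q y s.perm i := by
  rcases lt_or_gt_of_ne hi with h | h
  · have h1 : ¬ s.LePlus i := by simp [LePlus, hi, h.le]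
    have h2 : s.GeMinus i := Or.inl h
    have h3 : s.crossPlus i = ∅ := by
      refine filter_false_of_mem fun j _ hj => ?_
      exact absurd (hj.1.trans_le hj.2.1) h.asymm
    have h4 : s.nestPlus i = ∅ := filter_false_of_mem fun j _ hj => h1 hj.2.1
    rw [posWeight, h3, h4, downWeight, upWeight, if_neg h1, if_pos h, if_pos h, if_neg h.not_ge]
    simp only [crossMinus, nestMinus, h2, true_and, card_empty]
    ring
  · have h1 : s.LePlus i := Or.inl h
    have h2 : ¬ s.GeMinus i := by simp [GeMinus, hi, h.le]
    have h3 : s.crossMinus i = ∅ := by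
      refine filter_false_of_mem fun j _ hj => ?_
      exact absurd (hj.2.2.trans hj.2.1) h.asymm
    have h4 : s.nestMinus i = ∅ := filter_false_of_mem fun j _ hj => h2 hj.2.1
    rw [posWeight, h3, h4, downWeight, upWeight, if_pos h1, if_neg h.asymm, if_neg h.asymm,
      if_pos h.le, if_neg hi]
    simp only [crossPlus, nestPlus, h1, true_and, card_empty]
    ring

theorem posWeight_of_eq (p q y : R) (s : DecoratedPerm n) {i : Fin n} (hi : s.perm i = i) :
    posWeight p q y s i = if s.color ⟨i, hi⟩ then y * p ^ #{j | j < i ∧ i < s.perm j}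
      else p ^ #{j | i < j ∧ s.perm j < i} := by
  have h1 : s.LePlus i ↔ s.color ⟨i, hi⟩ = true := by simp [LePlus, hi]
  have h2 : s.GeMinus i ↔ s.color ⟨i, hi⟩ = false := by simp [GeMinus, hi]
  have h3 : s.crossPlus i = ∅ := by
    refine filter_false_of_mem fun j _ hj => ?_
    rw [hi] at hj; exact hj.1.not_ge hj.2.1
  have h4 : s.crossMinus i = ∅ := by
    refine filter_false_of_mem fun j _ hj => ?_
    rw [hi] at hj; exact hj.2.1.asymm hj.2.2
  rw [posWeight, h3, h4]
  simp only [nestPlus, nestMinus, h1, h2, hi]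
  cases s.color ⟨i, hi⟩ <;> simp

/-- The factor at a fixed point depends only on its own colour and the other factors on no colour,
so the sum over colourings factors into two-term sums. -/
theorem sum_color_weight (p q y : R) (σ : Equiv.Perm (Fin n)) :
    ∑ c : {i : Fin n // σ i = i} → Bool, ∏ i, posWeight p q y ⟨σ, c⟩ i =
      (∏ i, downWeight p q σ i) * ∏ i, upWeight p q y σ i := by
  rw [← prod_mul_distrib, ← Fintype.prod_subtype_mul_prod_subtype (fun i => σ i = i)]
  have h : ∀ i : {i : Fin n // σ i = i}, downWeight p q σ i * upWeight p q y σ i =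
      ∑ b : Bool, if b then y * p ^ #{j | j < i.1 ∧ i.1 < σ j}
        else p ^ #{j | i.1 < j ∧ σ j < i.1} := by
    rintro ⟨i, hi⟩
    have h0 : #{j | i < j ∧ j ≤ i ∧ i < σ j} = 0 := by
      rw [card_eq_zero, filter_eq_empty_iff]
      exact fun j _ hj => hj.1.not_ge hj.2.1
    simp [downWeight, upWeight, hi, h0]
  rw [prod_congr rfl fun i _ => h i, prod_univ_sum, Fintype.piFinset_univ, sum_mul]
  refine sum_congr rfl fun c _ => ?_
  rw [← Fintype.prod_subtype_mul_prod_subtype (fun i => σ i = i)]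
  congr 1
  · exact prod_congr rfl fun i _ => posWeight_of_eq p q y ⟨σ, c⟩ i.2
  · exact prod_congr rfl fun i _ => posWeight_of_ne p q y ⟨σ, c⟩ i.2

theorem sum_weight (p q y : R) :
    ∑ s : DecoratedPerm n,
        y ^ s.weakExceedances * q ^ (s.crossings + s.nonExceedances) * p ^ s.nestings =
      decoratedMotzkin p q y n 0 := by
  rw [← sum_perm_weight, ← (equivSigma n).sum_comp, Fintype.sum_sigma]
  refine sum_congr rfl fun σ _ => ?_
  rw [← sum_color_weight]
  exact sum_congr rfl fun c _ => (prod_posWeight p q y _).symm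

end DecoratedPerm

/-! ### Extraction of coefficients. -/

theorem X_pow_mul_eq_monomial (a b c : ℕ) :
    (MvPolynomial.X 0 ^ a * MvPolynomial.X 1 ^ b * MvPolynomial.X 2 ^ c :
      MvPolynomial (Fin 3) ℤ) =
    MvPolynomial.monomial (Finsupp.single 0 a + Finsupp.single 1 b + Finsupp.single 2 c) 1 := by
  simp [MvPolynomial.X_pow_eq_monomial, MvPolynomial.monomial_mul]

theorem single_add_eq_iff (a b c k l m : ℕ) :
    (Finsupp.single (0 : Fin 3) a + Finsupp.single 1 b + Finsupp.single 2 c =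
      Finsupp.single (0 : Fin 3) k + Finsupp.single 1 l + Finsupp.single 2 m) ↔
    a = k ∧ b = l ∧ c = m := by
  refine ⟨fun h => ?_, by rintro ⟨rfl, rfl, rfl⟩; rfl⟩
  have h0 := DFunLike.congr_fun h 0
  have h1 := DFunLike.congr_fun h 1
  have h2 := DFunLike.congr_fun h 2
  simp at h0 h1 h2
  exact ⟨h0, h1, h2⟩

end GeneratingFunction

theorem mainTheorem10 (n k l m : ℕ) :
    MvPolynomial.coeff
        (Finsupp.single (0 : Fin 3) k + Finsupp.single (1 : Fin 3) l + Finsupp.single (2 : Fin 3) m)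
        (PowerSeries.coeff n decoratedSeries)
      = (Finset.card (Finset.univ.filter fun s : DecoratedPerm n =>
          s.weakExceedances = k ∧ s.crossings + s.nonExceedances = l ∧ s.nestings = m) : ℤ) := by
  rw [decoratedSeries, coeff_jFraction]
  have h := DecoratedPerm.sum_weight (n := n) (MvPolynomial.X 2 : MvPolynomial (Fin 3) ℤ)
    (MvPolynomial.X 1) (MvPolynomial.X 0)
  rw [decoratedMotzkin] at h
  rw [← h, MvPolynomial.coeff_sum, Finset.card_filter, Nat.cast_sum]
  refine Finset.sum_congr rfl fun s _ => ?_
  rw [X_pow_mul_eq_monomial, MvPolynomial.coeff_monomial]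
  simp only [single_add_eq_iff]
  split_ifs <;> simp
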